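/- **Setting.** Let $\mathrm{Symm}$ be the $\mathbb Q$-algebra of symmetric functions (permutation-invariant formal power series of bounded degree in $x_0,x_1,\dots$ over $\mathbb Q$), identified with $MU_*\otimes\mathbb Q$ by $[\mathbb CP^0]=1$ and $[\mathbb CP^k]=p_k=\sum_i x_i^k$ for $k\ge 1$, and put $MU_{\mathbb Q}^*(X)=\prod_n H^n(X;\mathrm{Symm})$ (singular cohomology with cup product). Let $$\log_{MU}(t)=\sum_{n\ge 1}\frac{[\mathbb CP^{n-1}]}{n}\,t^n,\qquad F_{MU}(u,v)=\log_{MU}^{-1}\bigl(\log_{MU}(u)+\log_{MU}(v)\bigr),$$ $F_{MU}$ being the Quillen–Lazard formal group law, and let $\mathsf{st}_{MU}(t)=\exp(-\log_{MU}(t))$ be its Schneider–Teitelbaum modulus. For $x\in MU_{\mathbb Q}^*(X)$ with zero component in $H^0$, power series in $x$ are defined degree by degree. Put $$\check c_{MU}(x)=\exp(xT)=\sum_{k\ge 0}\frac{x^k}{k!}\,T^k\in\prod_n H^n(X;\mathrm{Symm}[T]).$$ The operator $\log_{MU}(\partial_T)=\sum_{n\ge1}\frac{[\mathbb CP^{n-1}]}{n}\partial_T^n$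 on $\mathrm{Symm}[T]$ is $\mathrm{Symm}$-linear ($T$ is an independent variable) and locally nilpotent; it generates the flow $\exp(s\log_{MU}(\partial_T))$, $s\in\mathbb Q$. Renormalization $Z_{\sqcup\!\sqcup}$ is the map $\prod_nH^n(X;\mathrm{Symm}[T])\to MU^*_{\mathbb Q}(X)$ induced by the coefficient map $$Z:\mathrm{Symm}[T]\to\mathrm{Symm},\qquad Z(f)=\bigl(\exp(-\log_{MU}(\partial_T))f\bigr)\big|_{T=0}.$$ **Proposition.** Let $X$ be a topological space, $\lambda:X\to\Omega S^2$ a continuous map, $b$ a class in $H^2(\Omega S^2;\mathbb Z)$ (for instance a generator), and write $b$ also for the image of $\lambda^*b$ in $MU_{\mathbb Q}^*(X)$. 1. Before setting $T=0$: $\exp(-\log_{MU}(\partial_T))\,\check c_{MU}(b)=\mathsf{st}_{MU}(b)\cdot\check c_{MU}(b)$ in $\prod_nH^n(X;\mathrm{Symm}[T])$. 2. $Z_{\sqcup\!\sqcup}\,\check c_{MU}(b)=\bigl(\exp(-\log_{MU}(\partial_T))\exp(bT)\bigr)\big|_{T=0}=\exp(-\log_{MU}(b))=\mathsf{st}_{MU}(b)$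 in $MU_{\mathbb Q}^*(X)$. 3. $F_{MU}$ is a commutative formal group law with logarithm $\log_{MU}$, i.e. $\log_{MU}(F_{MU}(u,v))=\log_{MU}(u)+\log_{MU}(v)$, and $\mathsf{st}_{MU}$ is a homomorphism from it to the multiplicative group: $\mathsf{st}_{MU}(F_{MU}(u,v))=\mathsf{st}_{MU}(u)\,\mathsf{st}_{MU}(v)$. 4. $Z$ is a change of quasi-shuffle product. Let $\mathfrak h^1$ be the $\mathbb Q$-vector space of words in letters $y_1,y_2,\dots$, with the shuffle product $\sqcup\!\sqcup$ and the quasi-shuffle product $*$ given by $y_i\diamondsuit y_j=y_{i+j}$. If $\psi:(\mathfrak h^1,\sqcup\!\sqcup)\to\mathrm{Symm}[T]$ and $\chi:(\mathfrak h^1,*)\to\mathrm{Symm}$ are unital $\mathbb Q$-algebra homomorphisms with $\psi(y_1)=-T$ and $\chi(y_r)=[\mathbb CP^{r-1}]$ for all $r\ge1$, then $Z(\psi(y_1^n))=\chi(y_1^n)$ for every word $y_1^n=y_1\cdots y_1$, $n\ge0$. -/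

import Mathlib

noncomputable section

namespace Morava

universe u v

open Finset

/-! ### Singular cochains with the cup product -/

/-- Singular `n`-simplices of `X`. -/
abbrev Sing (n : ℕ) (X : Type u) [TopologicalSpace X] : Type u :=
  C(stdSimplex ℝ (Fin (n + 1)), X)

section Cochains

variable {X : Type u} [TopologicalSpace X] {n m k : ℕ}

/-- The singular `m`-simplex obtained from the `n`-simplex `σ` by precomposition with the affine map
`Δ^m → Δ^n` which sends the vertex `j` to the vertex `φ j` (only used when `φ j ≤ n` for all
`j ≤ m`). -/
def Sing.vert (φ : ℕ → ℕ) (m : ℕ) (σ : Sing n X) : Sing m X :=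
  σ.comp ⟨stdSimplex.map (fun j : Fin (m + 1) => Fin.ofNat (n + 1) (φ j)),
    stdSimplex.continuous_map _⟩

/-- The subsimplex of `σ` spanned by the vertices `p, p + 1, …, p + m`. -/
def Sing.sub (p m : ℕ) (σ : Sing n X) : Sing m X :=
  σ.vert (fun j => p + j) m

/-- The `i`-th vertex is skipped by this function. -/
def skip (i j : ℕ) : ℕ := if j < i then j else j + 1

/-- The `i`-th face of a singular `(n + 1)`-simplex. -/
def Sing.face (i : ℕ) (σ : Sing (n + 1) X) : Sing n X :=
  σ.vert (skip i) n

theorem Sing.vert_vert (φ ψ : ℕ → ℕ) (σ : Sing n X) (h : ∀ j ≤ k, φ j ≤ m) :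
    (σ.vert ψ m).vert φ k = σ.vert (fun j => ψ (φ j)) k := by
  ext x
  simp only [Sing.vert, ContinuousMap.comp_apply, ContinuousMap.coe_mk, stdSimplex.map_comp_apply]
  congr 2
  funext j
  have hj := h j (Nat.lt_succ_iff.mp j.2)
  simp only [Function.comp]
  congr 2
  simp [Fin.ofNat, Nat.mod_eq_of_lt (Nat.lt_succ_of_le hj)]

theorem Sing.vert_congr {φ ψ : ℕ → ℕ} (σ : Sing n X) (h : ∀ j ≤ m, φ j = ψ j) :
    σ.vert φ m = σ.vert ψ m := by
  unfold Sing.vert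
  congr 2
  funext x
  congr 1
  funext j
  rw [h j (Nat.lt_succ_iff.mp j.2)]

variable (X) in
/-- Families `(fₙ)` of singular `n`-cochains of `X` with coefficients in `K`, one for each `n`:
the completed cochain complex `∏ₙ Cⁿ(X; K)`. -/
def Cochain (K : Type v) : Type (max u v) := ∀ n : ℕ, Sing n X → K

variable {K : Type v}

@[ext] theorem Cochain.ext {f g : Cochain X K} (h : ∀ n σ, f n σ = g n σ) : f = g :=
  funext fun n => funext fun σ => h n σ

variable [CommRing K]

instance : AddCommGroup (Cochain X K) :=
  inferInstanceAs (AddCommGroup (∀ n : ℕ, Sing n X → K))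

instance : Module K (Cochain X K) :=
  inferInstanceAs (Module K (∀ n : ℕ, Sing n X → K))

@[simp] theorem Cochain.add_app (f g : Cochain X K) (σ : Sing n X) :
    (f + g) n σ = f n σ + g n σ := rfl
@[simp] theorem Cochain.sub_app (f g : Cochain X K) (σ : Sing n X) :
    (f - g) n σ = f n σ - g n σ := rfl
@[simp] theorem Cochain.neg_app (f : Cochain X K) (σ : Sing n X) :
    (-f) n σ = - f n σ := rfl
@[simp] theorem Cochain.zero_app (σ : Sing n X) : (0 : Cochain X K) n σ = 0 := rfl
@[simp] theorem Cochain.smul_app (c : K) (f : Cochain X K) (σ : Sing n X) :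
    (c • f) n σ = c * f n σ := rfl

/-- The unit cochain: constantly `1` on vertices. -/
instance : One (Cochain X K) := ⟨fun n _ => if n = 0 then 1 else 0⟩

theorem Cochain.one_app (σ : Sing n X) : (1 : Cochain X K) n σ = if n = 0 then 1 else 0 := rfl

/-- The cup product (Alexander–Whitney). -/
instance : Mul (Cochain X K) :=
  ⟨fun f g n σ => ∑ x ∈ HasAntidiagonal.antidiagonal n, f x.1 (σ.sub 0 x.1) * g x.2 (σ.sub x.1 x.2)⟩

theorem Cochain.mul_app (f g : Cochain X K) (σ : Sing n X) :
    (f * g) n σ = ∑ x ∈ HasAntidiagonal.antidiagonal n, f x.1 (σ.sub 0 x.1) * g x.2 (σ.sub x.1 x.2) := rfl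

theorem Sing.sub_self (σ : Sing n X) : σ.sub 0 n = σ := by
  ext x
  have : (fun j : Fin (n + 1) => Fin.ofNat (n + 1) (0 + (j : ℕ))) = id := by
    funext j
    exact Fin.ext (by simp [Fin.ofNat, Nat.mod_eq_of_lt j.2])
  change σ (stdSimplex.map _ x) = σ x
  rw [this, stdSimplex.map_id_apply]

theorem Sing.sub_sub (σ : Sing n X) (p q l : ℕ) (h : q + l ≤ m) :
    (σ.sub p m).sub q l = σ.sub (p + q) l := by
  unfold Sing.sub
  rw [Sing.vert_vert _ _ _ (by intros; omega)]
  exact Sing.vert_congr _ (by intros; omega)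

theorem Cochain.mul_assoc' (f g h : Cochain X K) : f * g * h = f * (g * h) := by
  ext n σ
  simp only [Cochain.mul_app, Finset.sum_mul, Finset.mul_sum, Finset.sum_sigma']
  refine Finset.sum_nbij' (fun ⟨⟨_i, j⟩, ⟨k, l⟩⟩ ↦ ⟨(k, l + j), (l, j)⟩)
    (fun ⟨⟨i, _j⟩, ⟨k, l⟩⟩ ↦ ⟨(i + k, l), (i, k)⟩) ?_ ?_ ?_ ?_ ?_
  · rintro ⟨⟨i, j⟩, ⟨k, l⟩⟩ hx
    simp only [mem_sigma, HasAntidiagonal.mem_antidiagonal] at hx ⊢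
    obtain ⟨rfl, rfl⟩ := hx
    simp only [add_assoc, and_self]
  · rintro ⟨⟨i, j⟩, ⟨k, l⟩⟩ hx
    simp only [mem_sigma, HasAntidiagonal.mem_antidiagonal] at hx ⊢
    obtain ⟨rfl, rfl⟩ := hx
    simp only [add_assoc, and_self]
  · rintro ⟨⟨i, j⟩, ⟨k, l⟩⟩ hx
    simp only [mem_sigma, HasAntidiagonal.mem_antidiagonal] at hx
    obtain ⟨rfl, rfl⟩ := hx
    rfl
  · rintro ⟨⟨i, j⟩, ⟨k, l⟩⟩ hx
    simp only [mem_sigma, HasAntidiagonal.mem_antidiagonal] at hx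
    obtain ⟨rfl, rfl⟩ := hx
    rfl
  · rintro ⟨⟨i, j⟩, ⟨k, l⟩⟩ hx
    simp only [mem_sigma, HasAntidiagonal.mem_antidiagonal] at hx
    obtain ⟨rfl, rfl⟩ := hx
    simp only
    rw [Sing.sub_sub _ _ _ _ (by omega), Sing.sub_sub _ _ _ _ (by omega),
      Sing.sub_sub _ _ _ _ (by omega), Sing.sub_sub _ _ _ _ (by omega), mul_assoc]
    simp

instance : Ring (Cochain X K) :=
  { (inferInstance : AddCommGroup (Cochain X K)) with
    mul_assoc := Cochain.mul_assoc'
    one_mul := by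
      intro f
      ext n σ
      rw [Cochain.mul_app, Finset.sum_eq_single (0, n)]
      · simp [Cochain.one_app, Sing.sub_self]
      · rintro ⟨p, q⟩ hx hne
        rw [HasAntidiagonal.mem_antidiagonal] at hx
        have : p ≠ 0 := by
          rintro rfl
          exact hne (by simp_all)
        simp [Cochain.one_app, this]
      · simp
    mul_one := by
      intro f
      ext n σ
      rw [Cochain.mul_app, Finset.sum_eq_single (n, 0)]
      · simp [Cochain.one_app, Sing.sub_self]
      · rintro ⟨p, q⟩ hx hne
        rw [HasAntidiagonal.mem_antidiagonal] at hx
        have : q ≠ 0 := by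
          rintro rfl
          exact hne (by simp_all)
        simp [Cochain.one_app, this]
      · simp
    left_distrib := by
      intro f g h
      ext n σ
      simp [Cochain.mul_app, mul_add, Finset.sum_add_distrib]
    right_distrib := by
      intro f g h
      ext n σ
      simp [Cochain.mul_app, add_mul, Finset.sum_add_distrib]
    zero_mul := by
      intro f
      ext n σ
      simp [Cochain.mul_app]
    mul_zero := by
      intro f
      ext n σ
      simp [Cochain.mul_app] }

instance : Algebra K (Cochain X K) :=
  Algebra.ofModule
    (by
      intro c f g
      ext n σ
      simp [Cochain.mul_app, Finset.mul_sum, mul_assoc])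
    (by
      intro c f g
      ext n σ
      simp [Cochain.mul_app, Finset.mul_sum, mul_left_comm])

/-- The coboundary `(d f)(σ) = ∑ᵢ (-1)ⁱ f(∂ᵢ σ)`, as a function. -/
def Cochain.dFun (f : Cochain X K) : Cochain X K := fun n => match n with
  | 0 => fun _ => 0
  | n + 1 => fun σ => ∑ i ∈ range (n + 2), (-1) ^ i * f n (Sing.face i σ)

theorem Cochain.dFun_succ (f : Cochain X K) (σ : Sing (n + 1) X) :
    f.dFun (n + 1) σ = ∑ i ∈ range (n + 2), (-1) ^ i * f n (Sing.face i σ) := rfl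

theorem Cochain.dFun_zero (f : Cochain X K) (σ : Sing 0 X) : f.dFun 0 σ = 0 := rfl

/-- The coboundary `(d f)(σ) = ∑ᵢ (-1)ⁱ f(∂ᵢ σ)`. -/
def Cochain.d : Cochain X K →ₗ[K] Cochain X K where
  toFun := Cochain.dFun
  map_add' f g := by
    ext n σ
    cases n <;> simp [Cochain.dFun_succ, Cochain.dFun_zero, mul_add, Finset.sum_add_distrib]
  map_smul' c f := by
    ext n σ
    cases n <;> simp [Cochain.dFun_succ, Cochain.dFun_zero, Finset.mul_sum, mul_left_comm]

@[simp] theorem Cochain.d_zero_app (f : Cochain X K) (σ : Sing 0 X) : Cochain.d f 0 σ = 0 := rfl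

theorem Cochain.d_succ_app (f : Cochain X K) (σ : Sing (n + 1) X) :
    Cochain.d f (n + 1) σ = ∑ i ∈ range (n + 2), (-1) ^ i * f n (Sing.face i σ) := rfl

/-- The grading involution `f ↦ (-1)ⁿ f` on `n`-cochains. -/
def Cochain.sgn (f : Cochain X K) : Cochain X K := fun n σ => (-1) ^ n * f n σ

theorem Cochain.sgn_app (f : Cochain X K) (σ : Sing n X) :
    f.sgn n σ = (-1) ^ n * f n σ := rfl

theorem Cochain.sgn_sgn (f : Cochain X K) : f.sgn.sgn = f := by
  ext n σ
  simp [Cochain.sgn_app, ← mul_assoc, ← mul_pow]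

theorem Cochain.d_sgn (f : Cochain X K) : Cochain.d f.sgn = - (Cochain.d f).sgn := by
  ext n σ
  cases n with
  | zero => simp [Cochain.sgn_app]
  | succ n =>
    simp only [Cochain.neg_app, Cochain.sgn_app, Cochain.d_succ_app, Finset.mul_sum,
      ← Finset.sum_neg_distrib]
    refine Finset.sum_congr rfl fun i _ => ?_
    ring

theorem Sing.sub_zero_face_le (σ : Sing (n + 1) X) {i p : ℕ} (_hi : i ≤ p) (hp : p ≤ n) :
    (Sing.face i σ).sub 0 p = Sing.face i (σ.sub 0 (p + 1)) := by
  unfold Sing.sub Sing.face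
  rw [Sing.vert_vert _ _ _ (by intros; omega),
    Sing.vert_vert _ _ _ (by intros; unfold skip; split_ifs <;> omega)]
  exact Sing.vert_congr _ (by intros; simp)

theorem Sing.sub_zero_face_gt (σ : Sing (n + 1) X) {i p : ℕ} (hi : p < i) (hp : p ≤ n) :
    (Sing.face i σ).sub 0 p = σ.sub 0 p := by
  unfold Sing.sub Sing.face
  rw [Sing.vert_vert _ _ _ (by intros; omega)]
  exact Sing.vert_congr _ (by intros; unfold skip; split_ifs <;> omega)

theorem Sing.sub_face_le (σ : Sing (n + 1) X) {i p q : ℕ} (hi : i ≤ p) (hp : p + q ≤ n) :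
    (Sing.face i σ).sub p q = σ.sub (p + 1) q := by
  unfold Sing.sub Sing.face
  rw [Sing.vert_vert _ _ _ (by intros; omega)]
  exact Sing.vert_congr _ (by intros; unfold skip; split_ifs <;> omega)

theorem Sing.sub_face_gt (σ : Sing (n + 1) X) {i p q : ℕ} (hp : p + q ≤ n) :
    (Sing.face (p + i) σ).sub p q = Sing.face i (σ.sub p (q + 1)) := by
  unfold Sing.sub Sing.face
  rw [Sing.vert_vert _ _ _ (by intros; omega),
    Sing.vert_vert _ _ _ (by intros; unfold skip; split_ifs <;> omega)]
  exact Sing.vert_congr _ (by intros; unfold skip; split_ifs <;> omega)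

theorem Sing.face_last (σ : Sing n X) (p : ℕ) :
    Sing.face (p + 1) (σ.sub 0 (p + 1)) = σ.sub 0 p := by
  unfold Sing.sub Sing.face
  rw [Sing.vert_vert _ _ _ (by intros; unfold skip; split_ifs <;> omega)]
  exact Sing.vert_congr _ (by intros; unfold skip; split_ifs <;> omega)

theorem Sing.face_zero_sub (σ : Sing n X) (p q : ℕ) :
    Sing.face 0 (σ.sub p (q + 1)) = σ.sub (p + 1) q := by
  unfold Sing.sub Sing.face
  rw [Sing.vert_vert _ _ _ (by intros; unfold skip; split_ifs <;> omega)]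
  exact Sing.vert_congr _ (by intros; unfold skip; split_ifs <;> omega)

/-- The Leibniz rule for the cup product. -/
theorem Cochain.d_mul (f g : Cochain X K) :
    Cochain.d (f * g) = Cochain.d f * g + f.sgn * Cochain.d g := by
  ext n σ
  cases n with
  | zero => simp [Cochain.mul_app]
  | succ n =>
    rw [Cochain.add_app, Cochain.mul_app, Cochain.mul_app, Finset.Nat.sum_antidiagonal_succ,
      Finset.Nat.sum_antidiagonal_succ']
    simp only [Cochain.d_zero_app, zero_mul, zero_add, mul_zero]
    rw [← Finset.sum_add_distrib, Cochain.d_succ_app]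
    simp only [Cochain.mul_app, Finset.mul_sum]
    rw [Finset.sum_comm]
    refine Finset.sum_congr rfl ?_
    rintro ⟨p, q⟩ hx
    rw [HasAntidiagonal.mem_antidiagonal] at hx
    simp only at hx ⊢
    have h1 : n + 2 = (p + 1) + (q + 1) := by omega
    rw [h1, Finset.sum_range_add, Cochain.d_succ_app, Cochain.d_succ_app,
      Finset.sum_range_succ (n := p + 1), Finset.sum_range_succ' (n := q + 1), Cochain.sgn_app,
      Sing.face_last, Sing.face_zero_sub, add_mul, mul_add, Finset.sum_mul, Finset.mul_sum]
    have e1 : ∀ i ∈ range (p + 1),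
        (-1 : K) ^ i * (f p ((Sing.face i σ).sub 0 p) * g q ((Sing.face i σ).sub p q))
          = (-1) ^ i * f p (Sing.face i (σ.sub 0 (p + 1))) * g q (σ.sub (p + 1) q) := by
      intro i hi
      rw [mem_range] at hi
      rw [Sing.sub_zero_face_le σ (by omega) (by omega), Sing.sub_face_le σ (by omega) (by omega),
        mul_assoc]
    have e2 : ∀ i ∈ range (q + 1),
        (-1 : K) ^ (p + 1 + i) * (f p ((Sing.face (p + 1 + i) σ).sub 0 p)
            * g q ((Sing.face (p + 1 + i) σ).sub p q))
          = (-1) ^ p * f p (σ.sub 0 p) * ((-1) ^ (i + 1)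
            * g q (Sing.face (i + 1) (σ.sub p (q + 1)))) := by
      intro i hi
      rw [Sing.sub_zero_face_gt σ (by omega) (by omega), show p + 1 + i = p + (i + 1) by omega,
        Sing.sub_face_gt σ (by omega)]
      ring
    rw [Finset.sum_congr rfl e1, Finset.sum_congr rfl e2]
    ring

theorem Cochain.d_one : Cochain.d (1 : Cochain X K) = 0 := by
  ext n σ
  rcases n with _ | _ | n
  · simp
  · simp [Cochain.d_succ_app, Cochain.one_app, Finset.sum_range_succ]
  · simp [Cochain.d_succ_app, Cochain.one_app]

end Cochains

/-! ### Singular cohomology -/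

section Cohomology

variable (X : Type u) [TopologicalSpace X] (K : Type v) [CommRing K]

/-- The algebra of cocycles `∏ₙ Zⁿ(X; K)`. -/
def cocycles : Subalgebra K (Cochain X K) where
  carrier := {f | Cochain.d f = 0}
  mul_mem' := by
    intro f g hf hg
    simp only [Set.mem_ofPred_eq] at *
    rw [Cochain.d_mul, hf, hg, zero_mul, mul_zero, add_zero]
  add_mem' := by
    intro f g hf hg
    simp only [Set.mem_ofPred_eq] at *
    rw [map_add, hf, hg, add_zero]
  algebraMap_mem' := by
    intro c
    simp only [Set.mem_ofPred_eq, Algebra.algebraMap_eq_smul_one, map_smul, Cochain.d_one, smul_zero]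

/-- Cohomologous cocycles; coboundaries form a two-sided ideal in the algebra of cocycles. -/
def cohomologous : RingCon (cocycles X K) where
  r f g := ∃ w : Cochain X K, Cochain.d w = (f : Cochain X K) - g
  iseqv :=
    { refl := fun f => ⟨0, by simp⟩
      symm := by
        rintro f g ⟨w, hw⟩
        exact ⟨-w, by rw [map_neg, hw, neg_sub]⟩
      trans := by
        rintro f g h ⟨w, hw⟩ ⟨w', hw'⟩
        exact ⟨w + w', by rw [map_add, hw, hw', sub_add_sub_cancel]⟩ }
  add' := by
    rintro a b c e ⟨w, hw⟩ ⟨w', hw'⟩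
    refine ⟨w + w', ?_⟩
    rw [map_add, hw, hw']
    push_cast
    abel
  mul' := by
    rintro a b c e ⟨w, hw⟩ ⟨w', hw'⟩
    refine ⟨w * c + (b : Cochain X K).sgn * w', ?_⟩
    have hc : Cochain.d (c : Cochain X K) = 0 := c.2
    have hb : Cochain.d (b : Cochain X K) = 0 := b.2
    have hb' : (0 : Cochain X K).sgn = 0 := by
      ext n σ
      simp [Cochain.sgn_app]
    rw [map_add, Cochain.d_mul, Cochain.d_mul, Cochain.d_sgn, Cochain.sgn_sgn, hw, hw', hc, hb, hb',
      mul_zero, neg_zero, zero_mul, add_zero, zero_add]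
    push_cast
    rw [sub_mul, mul_sub, sub_add_sub_cancel]

/-- The singular cohomology ring `H^*(X; K) = ∏ₙ Hⁿ(X; K)` (completed: infinite sums of classes of
different degrees are allowed), with the cup product. -/
abbrev Coh : Type (max u v) := (cohomologous X K).Quotient

variable {X K}

/-- The cohomology class of a cocycle. -/
def Coh.mk (f : cocycles X K) : Coh X K := (f : (cohomologous X K).Quotient)

theorem Coh.mk_eq {f g : cocycles X K} :
    Coh.mk f = Coh.mk g ↔ ∃ w : Cochain X K, Cochain.d w = (f : Cochain X K) - g :=
  RingCon.eq _

theorem Coh.mk_surjective : Function.Surjective (Coh.mk (X := X) (K := K)) :=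
  Quotient.mk''_surjective

/-- A representing cocycle. -/
def Coh.rep (x : Coh X K) : cocycles X K := (Coh.mk_surjective x).choose

theorem Coh.mk_rep (x : Coh X K) : Coh.mk x.rep = x := (Coh.mk_surjective x).choose_spec

/-- Given classes `y₀, y₁, …`, the class `z` whose component in `Hⁿ(X; K)` is that of `yₙ`. -/
def Coh.assemble (y : ℕ → Coh X K) : Coh X K :=
  Coh.mk ⟨fun n => (y n).rep.1 n, by
    change Cochain.d _ = 0
    ext n σ
    cases n with
    | zero => rfl
    | succ n =>
      have h : Cochain.d (y n).rep.1 = 0 := (y n).rep.2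
      exact congrFun (congrFun h (n + 1)) σ⟩

/-- `x` is homogeneous of degree `n`, that is, `x` lies in `Hⁿ(X; K)`. -/
def Coh.IsHomogeneous (n : ℕ) (x : Coh X K) : Prop :=
  ∃ z : cocycles X K, (∀ m, m ≠ n → z.1 m = 0) ∧ Coh.mk z = x

/-- Classes are determined by their components, and `assemble` has the stated components. -/
theorem Coh.assemble_mk (z : ℕ → cocycles X K) (w : cocycles X K) (h : ∀ n, w.1 n = (z n).1 n) :
    Coh.assemble (fun n => Coh.mk (z n)) = Coh.mk w := by
  have H : ∀ n, ∃ c : Cochain X K, Cochain.d c = ((Coh.mk (z n)).rep : Cochain X K) - z n :=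
    fun n => Coh.mk_eq.mp (Coh.mk_rep _)
  choose c hc using H
  refine Coh.mk_eq.mpr ⟨fun n => c (n + 1) n, ?_⟩
  ext n σ
  have h2 := congrFun (congrFun (hc n) n) σ
  cases n with
  | zero =>
    rw [Cochain.sub_app, h]
    exact h2
  | succ n =>
    rw [Cochain.sub_app, h]
    exact h2

/-- The value `f(x) = ∑ₖ fₖ xᵏ` of a power series at a class `x` without component in `H⁰`: in
degree `n`, only the terms with `k ≤ n` contribute. -/
def Coh.eval (f : PowerSeries K) (x : Coh X K) : Coh X K :=
  Coh.assemble fun n => ∑ k ∈ range (n + 1), PowerSeries.coeff k f • x ^ k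

/-- The exponential of a class without component in `H⁰`. -/
def Coh.exp [Algebra ℚ K] (x : Coh X K) : Coh X K := Coh.eval (PowerSeries.exp K) x

variable {L : Type*} [CommRing L]

/-- The map of cochains induced by an additive map of coefficients. -/
def Cochain.map (φ : K →+ L) : Cochain X K →+ Cochain X L where
  toFun f := fun n σ => φ (f n σ)
  map_zero' := by
    ext n σ
    exact map_zero φ
  map_add' f g := by
    ext n σ
    exact map_add φ _ _

theorem Cochain.map_app (φ : K →+ L) (f : Cochain X K) {n : ℕ} (σ : Sing n X) :
    Cochain.map φ f n σ = φ (f n σ) := rfl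

theorem Cochain.d_map (φ : K →+ L) (f : Cochain X K) :
    Cochain.d (Cochain.map φ f) = Cochain.map φ (Cochain.d f) := by
  ext n σ
  cases n with
  | zero => exact (map_zero φ).symm
  | succ n =>
    rw [Cochain.map_app, Cochain.d_succ_app, Cochain.d_succ_app, map_sum]
    refine Finset.sum_congr rfl fun i _ => ?_
    rcases Nat.even_or_odd i with h | h <;> simp [h.neg_one_pow, Cochain.map_app]

/-- The map `H^*(X; K) → H^*(X; L)` induced by an additive map of coefficients. -/
def Coh.map (φ : K →+ L) : Coh X K →+ Coh X L where
  toFun := Quotient.map'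
    (fun f : cocycles X K => (⟨Cochain.map φ f.1, by
      have h : Cochain.d f.1 = 0 := f.2
      change Cochain.d _ = 0
      rw [Cochain.d_map, h, map_zero]⟩ : cocycles X L))
    (by
      rintro f g ⟨w, hw⟩
      exact ⟨Cochain.map φ w, by rw [Cochain.d_map, hw, map_sub]⟩)
  map_zero' := congrArg Coh.mk (Subtype.ext (map_zero (Cochain.map φ)))
  map_add' := by
    intro x y
    obtain ⟨f, rfl⟩ := Coh.mk_surjective x
    obtain ⟨g, rfl⟩ := Coh.mk_surjective y
    exact congrArg Coh.mk (Subtype.ext (map_add (Cochain.map φ) _ _))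

variable {Y : Type*} [TopologicalSpace Y]

/-- The map of cochains induced by a continuous map. -/
def Cochain.pullback (h : C(X, Y)) : Cochain Y K →+ Cochain X K where
  toFun f := fun _ σ => f _ (h.comp σ)
  map_zero' := rfl
  map_add' _ _ := rfl

theorem Cochain.d_pullback (h : C(X, Y)) (f : Cochain Y K) :
    Cochain.d (Cochain.pullback h f) = Cochain.pullback h (Cochain.d f) := by
  ext n σ
  cases n <;> rfl

/-- The map `h^* : H^*(Y; K) → H^*(X; K)` induced by a continuous map `h : X → Y`. -/
def Coh.pullback (h : C(X, Y)) : Coh Y K →+ Coh X K where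
  toFun := Quotient.map'
    (fun f : cocycles Y K => (⟨Cochain.pullback h f.1, by
      have hf : Cochain.d f.1 = 0 := f.2
      change Cochain.d _ = 0
      rw [Cochain.d_pullback, hf, map_zero]⟩ : cocycles X K))
    (by
      rintro f g ⟨w, hw⟩
      exact ⟨Cochain.pullback h w, by rw [Cochain.d_pullback, hw, map_sub]⟩)
  map_zero' := rfl
  map_add' := by
    intro x y
    obtain ⟨f, rfl⟩ := Coh.mk_surjective x
    obtain ⟨g, rfl⟩ := Coh.mk_surjective y
    rfl

end Cohomology

/-! ### The based loop space of the two-sphere -/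

/-- The two-sphere. -/
abbrev S2 : Type := Metric.sphere (0 : EuclideanSpace ℝ (Fin 3)) 1

/-- The base point of the two-sphere. -/
def S2.base : S2 := ⟨EuclideanSpace.single 0 1, by simp⟩

/-- The based loop space `ΩS²`. -/
abbrev LoopS2 : Type := Path S2.base S2.base

/-! ### The rational complex cobordism ring and its formal group law -/

/-- The ring of symmetric functions over `ℚ`: formal power series of bounded degree in the variables
`x₀, x₁, …` which are invariant under permutations of the variables. It is identified with the
rational complex cobordism ring `MU_* ⊗ ℚ`, see `cp`. -/
def Symm : Subalgebra ℚ (MvPowerSeries ℕ ℚ) where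
  carrier := {f | (∃ D : ℕ, ∀ m : ℕ →₀ ℕ, D < m.degree → MvPowerSeries.coeff m f = 0) ∧
    ∀ e : Equiv.Perm ℕ, MvPowerSeries.renameEquiv ℚ e f = f}
  mul_mem' := by
    rintro f g ⟨⟨D, hD⟩, hf⟩ ⟨⟨E, hE⟩, hg⟩
    refine ⟨⟨D + E, fun m hm => ?_⟩, fun e => by rw [map_mul, hf, hg]⟩
    classical
    rw [MvPowerSeries.coeff_mul]
    refine Finset.sum_eq_zero ?_
    rintro ⟨a, b⟩ hab
    rw [HasAntidiagonal.mem_antidiagonal] at hab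
    have h : a.degree + b.degree = m.degree := by rw [← hab, map_add]
    by_cases ha : D < a.degree
    · rw [hD a ha, zero_mul]
    · rw [hE b (by omega), mul_zero]
  add_mem' := by
    rintro f g ⟨⟨D, hD⟩, hf⟩ ⟨⟨E, hE⟩, hg⟩
    refine ⟨⟨D + E, fun m hm => ?_⟩, fun e => by rw [map_add, hf, hg]⟩
    rw [map_add, hD m (by omega), hE m (by omega), add_zero]
  algebraMap_mem' := by
    intro c
    refine ⟨⟨0, fun m hm => ?_⟩, fun e => AlgEquiv.commutes _ c⟩
    classical
    rw [MvPowerSeries.algebraMap_apply, MvPowerSeries.coeff_C, if_neg]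
    rintro rfl
    simp at hm

/-- The power sum `pₖ = ∑ᵢ xᵢᵏ` (for `k ≥ 1`). -/
def powerSum (k : ℕ) : Symm :=
  ⟨fun m => open Classical in if ∃ i, m = Finsupp.single i k then 1 else 0, by
    classical
    refine ⟨⟨k, fun m hm => ?_⟩, fun e => ?_⟩
    · refine if_neg ?_
      rintro ⟨i, rfl⟩
      simp at hm
    · ext m
      obtain ⟨x, rfl⟩ : ∃ x, m = Finsupp.embDomain e.toEmbedding x := by
        refine ⟨Finsupp.embDomain e.symm.toEmbedding m, ?_⟩
        ext i
        obtain ⟨j, rfl⟩ := e.surjective i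
        obtain ⟨l, rfl⟩ := e.symm.surjective j
        rw [← Equiv.coe_toEmbedding e, Finsupp.embDomain_apply_self,
          ← Equiv.coe_toEmbedding e.symm, Finsupp.embDomain_apply_self]
        simp
      have h1 := MvPowerSeries.coeff_embDomain_rename (R := ℚ) e.toEmbedding
        (fun m => if ∃ i, m = Finsupp.single i k then 1 else 0) x
      refine h1.trans ?_
      refine if_congr ?_ rfl rfl
      constructor
      · rintro ⟨i, rfl⟩
        exact ⟨e i, by simp [Finsupp.embDomain_single]⟩
      · rintro ⟨i, hi⟩
        refine ⟨e.symm i, Finsupp.embDomain_injective e.toEmbedding ?_⟩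
        rw [hi, Finsupp.embDomain_single]
        simp⟩

/-- The class of the complex projective space `ℂP^k` in `MU_* ⊗ ℚ`: the generator `pₖ` for `k ≥ 1`,
and `1` for the point `ℂP⁰`. -/
def cp (k : ℕ) : Symm := if k = 0 then 1 else powerSum k

/-- The logarithm `∑_{n ≥ 1} [ℂP^{n-1}] / n · Xⁿ` of complex cobordism. -/
def logMU : PowerSeries Symm :=
  PowerSeries.mk fun n => if n = 0 then 0 else (1 / n : ℚ) • cp (n - 1)

/-- The coefficients of the compositional inverse `g` of a power series `f = X + ⋯`, obtained by
comparing the coefficients of `Xⁿ` in `g(f(X)) = X`. -/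
def compInvCoeff {K : Type*} [CommRing K] (f : PowerSeries K) (n : ℕ) : K :=
  (if n = 1 then 1 else 0) -
    ∑ k : Fin n, compInvCoeff f k * PowerSeries.coeff n (f ^ (k : ℕ))

/-- The Quillen–Lazard formal group law `log_MU⁻¹(log_MU(X) + log_MU(Y))`. -/
def fglMU : MvPowerSeries (Fin 2) Symm :=
  (PowerSeries.mk (compInvCoeff logMU)).subst
    (logMU.subst (MvPowerSeries.X 0 : MvPowerSeries (Fin 2) Symm) +
      logMU.subst (MvPowerSeries.X 1 : MvPowerSeries (Fin 2) Symm))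

/-- The Schneider–Teitelbaum modulus `exp(-log_MU(X))` as a power series. -/
def stSeries : PowerSeries Symm := (PowerSeries.exp Symm).subst (-logMU)

/-! ### Cartier's flow and renormalization -/

open Polynomial in
/-- `log_MU(∂_T) = ∑_{n ≥ 1} [ℂP^{n-1}] / n · ∂_Tⁿ`, as an operator on polynomials in `T`. -/
def logMUDiff : Symm[X] →ₗ[Symm] Symm[X] :=
  (Polynomial.basisMonomials Symm).constr Symm fun n =>
    ∑ j ∈ range (n + 1), PowerSeries.coeff j logMU • (Polynomial.derivative^[j]) (X ^ n : Symm[X])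

open Polynomial in
/-- The exponential `∑ₖ Nᵏ / k!` of an operator `N` on polynomials which lowers the degree (so that
`Nᵏ` kills `Tⁿ` for `k > n`). -/
def expDiff (N : Symm[X] →ₗ[Symm] Symm[X]) : Symm[X] →ₗ[Symm] Symm[X] :=
  (Polynomial.basisMonomials Symm).constr Symm fun n =>
    ∑ k ∈ range (n + 1), (1 / (k.factorial : ℚ)) • (N ^ k) (X ^ n : Symm[X])

open Polynomial in
/-- Cartier's renormalization flow `exp(s log_MU(∂_T))`, with generator `log_MU(∂_T)`. -/
def cartierFlow (s : ℚ) : Symm[X] →ₗ[Symm] Symm[X] := expDiff (s • logMUDiff)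

open Polynomial in
/-- Renormalization on coefficients: Cartier's flow at time `-1`, evaluated at `T = 0`. -/
def renorm : Symm[X] →ₗ[Symm] Symm := Polynomial.leval (0 : Symm) ∘ₗ cartierFlow (-1)

section Classes

open Polynomial

variable {X : Type u} [TopologicalSpace X]

/-- Renormalization `MU_ℚ^*(X)[T] → MU_ℚ^*(X)`, where `MU_ℚ^*(X) = H^*(X; MU_* ⊗ ℚ)`. -/
def Zsh : Coh X Symm[X] →+ Coh X Symm := Coh.map renorm.toAddMonoidHom

/-- The generalized Chern character `exp(x T) = ∑ₖ xᵏ / k! · Tᵏ`. -/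
def chernMU (x : Coh X Symm) : Coh X Symm[X] :=
  Coh.exp ((Polynomial.X : Symm[X]) • Coh.map (Polynomial.C : Symm →+* Symm[X]).toAddMonoidHom x)

/-- The Schneider–Teitelbaum modulus evaluated at a class. -/
def stMU (x : Coh X Symm) : Coh X Symm := Coh.eval stSeries x

/-- The class in `MU_ℚ^*(X)` of the pull-back along `X → ΩS²` of an integral class of `ΩS²`. -/
def classMU (lam : C(X, LoopS2)) (b : Coh LoopS2 ℤ) : Coh X Symm :=
  Coh.map (Int.castRingHom Symm).toAddMonoidHom (Coh.pullback lam b)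

end Classes

/-! ### Quasi-shuffle products -/

/-- The space `𝔥¹` with basis the words in the letters `y₁, y₂, …`. -/
abbrev Words : Type := List ℕ+ →₀ ℚ

/-- Prefix a letter to all words. -/
def Words.cons (a : ℕ+) : Words →ₗ[ℚ] Words := Finsupp.lmapDomain ℚ ℚ (List.cons a)

/-- The quasi-shuffle product of two words for the product `y_i ♢ y_j = q y_{i+j}` on letters:
`q = 0` is the shuffle product, `q = 1` the product of quasi-symmetric functions. -/
def quasiShuffle (q : ℚ) : List ℕ+ → List ℕ+ → Words
  | [], v => Finsupp.single v 1
  | a :: u, [] => Finsupp.single (a :: u) 1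
  | a :: u, b :: v =>
    Words.cons a (quasiShuffle q u (b :: v)) + Words.cons b (quasiShuffle q (a :: u) v) +
      q • Words.cons (a + b) (quasiShuffle q u v)
termination_by u v => u.length + v.length

/-- `χ` is a unital homomorphism from `𝔥¹`, with the quasi-shuffle product with parameter `q`, to
the algebra `A`. -/
def IsCharacter (q : ℚ) {A : Type*} [Semiring A] [Module ℚ A] (χ : Words →ₗ[ℚ] A) : Prop :=
  χ (Finsupp.single [] 1) = 1 ∧ ∀ u v : List ℕ+,
    χ (quasiShuffle q u v) = χ (Finsupp.single u 1) * χ (Finsupp.single v 1)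

end Morava

end

open Morava

/-!
The whole proof is governed by one observation: on the generating series `E(t) = exp(T t)` of the
divided powers `Tⁿ / n!`, an operator `f(∂_T)` acts as multiplication by `f(t)`
(`coeffMap_expSeries_of_symbol`). As the coefficientwise action of a linear operator on polynomials
in `T` commutes with multiplication by power series in `t` with constant coefficients, `f(∂_T)ᵏ`
multiplies `E` by `f(t)ᵏ`, and the flow `exp(f(∂_T))` multiplies it by `exp(f(t))`
(`coeffMap_expSeries_of_exp`). For `f = -log_MU` the factor is the Schneider–Teitelbaum modulus
(`coeffMap_cartierFlow`).

*Classes.* Let `x` be the class of a cocycle `w` without component in degree `0`. Then `wᵏ` vanishes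
in degrees below `k`, so `f ↦ f(w) = ∑ₖ fₖ wᵏ` is well defined on cocycles. It is multiplicative
(`Cochain.series_mul`), compatible with substitution (`Cochain.series_subst`), and represents the
value `f(x)` (`Coh.eval_mk`). The Chern character is represented by `E(w)`, and a coefficient map
that is linear over the ground ring acts on it through the coefficients of `E`
(`Cochain.map_series_of_linear`, `Cochain.map_series_of_functional`). Hence the flow multiplies the
Chern character by the modulus of `x`, and setting `T = 0` leaves the modulus alone.

*Formal group law.* A series `f = X + ⋯` has a two-sided compositional inverse `g`, and
`g(f(X) + f(Y))` is a commutative formal group law because the addition of power series is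
associative and commutative (`formalGroupOfLog`). The modulus turns it into multiplication since
`exp` turns sums into products (`exp_subst_add`).

*Quasi-shuffles.* In the shuffle algebra `y₁ⁿ` is the divided power of `y₁`, so `ψ(y₁ⁿ)` is
`(-T)ⁿ / n!`, which `Z` sends to `(-1)ⁿ` times the coefficient of `tⁿ` in the modulus
(`renorm_map_replicate`). In the quasi-shuffle algebra the products `y_r * y₁ⁿ` telescope to
Newton's identity between the `y₁ⁿ` and the letters (`IsCharacter.newton`). Up to signs, the
differential equation `st' = -log' · st` is the same recursion for the coefficients of the modulus
(`succ_smul_coeff_stSeries`).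
-/

noncomputable section

namespace Morava

open Finset

/-! ### Compositional inverses and formal group laws with a logarithm -/

section FormalGroupLaws

variable {K : Type*} [CommRing K]

theorem coeff_subst_eq_sum {σ : Type*} (f : PowerSeries K) {g : MvPowerSeries σ K}
    (hg : MvPowerSeries.constantCoeff g = 0) (e : σ →₀ ℕ) {N : ℕ} (hN : e.degree ≤ N) :
    MvPowerSeries.coeff e (f.subst g) = ∑ k ∈ Finset.range (N + 1),
      PowerSeries.coeff k f * MvPowerSeries.coeff e (g ^ k) := by
  rw [PowerSeries.coeff_subst (PowerSeries.HasSubst.of_constantCoeff_zero hg)]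
  rw [finsum_eq_sum_of_support_subset (s := Finset.range (N + 1))]
  · simp
  -- the order of `g ^ k` is at least `k`, so the terms with `k > N` vanish
  · intro k hk
    by_contra hk'
    refine hk ?_
    have h : MvPowerSeries.coeff e (g ^ k) = 0 := by
      apply MvPowerSeries.coeff_of_lt_order
      refine lt_of_lt_of_le ?_ (MvPowerSeries.le_order_pow_of_constantCoeff_eq_zero k hg)
      simp at hk'
      exact_mod_cast (by omega : e.degree < k)
    simp [h]

theorem coeff_subst_eq_sum' (f : PowerSeries K) {g : PowerSeries K}
    (hg : PowerSeries.constantCoeff g = 0) {n N : ℕ} (hN : n ≤ N) :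
    PowerSeries.coeff n (f.subst g) = ∑ k ∈ Finset.range (N + 1),
      PowerSeries.coeff k f * PowerSeries.coeff n (g ^ k) :=
  coeff_subst_eq_sum f hg (Finsupp.single () n) (by simpa using hN)

theorem coeff_pow_self {f : PowerSeries K} (hf : PowerSeries.constantCoeff f = 0)
    (hf1 : PowerSeries.coeff 1 f = 1) (n : ℕ) : PowerSeries.coeff n (f ^ n) = 1 := by
  obtain ⟨h, rfl⟩ := PowerSeries.X_dvd_iff.mpr hf
  have h0 : PowerSeries.constantCoeff h = 1 := by
    simpa using (PowerSeries.coeff_succ_X_mul 0 h).symm.trans hf1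
  rw [mul_pow]
  have := PowerSeries.coeff_X_pow_mul (h ^ n) n 0
  simpa [h0] using this

/-- The recursion for `compInvCoeff` says that the coefficient of `Xⁿ` in `g(f(X))`, which is
`gₙ + ∑_{k < n} gₖ [Xⁿ] fᵏ`, agrees with that of `X`. -/
theorem compInv_subst {f : PowerSeries K} (hf : PowerSeries.constantCoeff f = 0)
    (hf1 : PowerSeries.coeff 1 f = 1) :
    (PowerSeries.mk (compInvCoeff f)).subst f = (PowerSeries.X : PowerSeries K) := by
  ext n
  rw [coeff_subst_eq_sum' _ hf le_rfl, Finset.sum_range_succ, coeff_pow_self hf hf1,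
    PowerSeries.coeff_mk, mul_one]
  conv_lhs => rw [compInvCoeff]
  rw [Finset.sum_range, PowerSeries.coeff_X]
  simp

theorem constantCoeff_compInv {f : PowerSeries K} :
    PowerSeries.constantCoeff (PowerSeries.mk (compInvCoeff f)) = 0 := by
  rw [← PowerSeries.coeff_zero_eq_constantCoeff_apply, PowerSeries.coeff_mk, compInvCoeff]
  simp

theorem coeff_one_compInv {f : PowerSeries K} :
    PowerSeries.coeff 1 (PowerSeries.mk (compInvCoeff f)) = 1 := by
  rw [PowerSeries.coeff_mk, compInvCoeff]
  simp [PowerSeries.coeff_one]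

/-- A left inverse is a right inverse: it agrees with the right inverse `substInvOfIsUnit`. -/
theorem subst_compInv {f : PowerSeries K} (hf : PowerSeries.constantCoeff f = 0)
    (hf1 : PowerSeries.coeff 1 f = 1) :
    f.subst (PowerSeries.mk (compInvCoeff f)) = (PowerSeries.X : PowerSeries K) := by
  have hu : IsUnit (PowerSeries.coeff 1 f) := by simp [hf1]
  have e : PowerSeries.mk (compInvCoeff f) = f.substInvOfIsUnit hu := by
    have h1 : PowerSeries.HasSubst f := PowerSeries.HasSubst.of_constantCoeff_zero' hf
    have h2 := PowerSeries.HasSubst.substInvOfIsUnit f hu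
    have h3 := PowerSeries.subst_comp_subst_apply h1 h2 (PowerSeries.mk (compInvCoeff f))
    rw [compInv_subst hf hf1, PowerSeries.subst_X h2,
      PowerSeries.subst_substInvOfIsUnit_right f hf hu, PowerSeries.X_subst] at h3
    exact h3.symm
  rw [e, PowerSeries.subst_substInvOfIsUnit_right f hf hu]

theorem subst_mvSubst {σ τ : Type*} (f : PowerSeries K) {u : MvPowerSeries σ K}
    (hu : MvPowerSeries.constantCoeff u = 0) {a : σ → MvPowerSeries τ K}
    (ha : MvPowerSeries.HasSubst a) :
    MvPowerSeries.subst a (f.subst u) = f.subst (MvPowerSeries.subst a u) :=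
  MvPowerSeries.subst_comp_subst_apply
    (PowerSeries.HasSubst.of_constantCoeff_zero hu).const ha _

theorem hasSubst_pair {τ : Type*} {a b : MvPowerSeries τ K}
    (ha : MvPowerSeries.constantCoeff a = 0) (hb : MvPowerSeries.constantCoeff b = 0) :
    MvPowerSeries.HasSubst ![a, b] :=
  MvPowerSeries.hasSubst_of_constantCoeff_zero fun s => by fin_cases s <;> simp [ha, hb]

/-- The series `g(f(X) + f(Y))`: the addition transported along `f`, when `g` is inverse to `f`. -/
def transportAdd (f g : PowerSeries K) : MvPowerSeries (Fin 2) K :=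
  g.subst (f.subst (MvPowerSeries.X 0 : MvPowerSeries (Fin 2) K) +
    f.subst (MvPowerSeries.X 1 : MvPowerSeries (Fin 2) K))

theorem subst_subst_of_inverse {f g : PowerSeries K}
    (hg : PowerSeries.constantCoeff g = 0) (hfg : f.subst g = (PowerSeries.X : PowerSeries K))
    {τ : Type*} {a : MvPowerSeries τ K} (ha : MvPowerSeries.constantCoeff a = 0) :
    f.subst (g.subst a) = a := by
  have h := PowerSeries.HasSubst.of_constantCoeff_zero ha
  rw [← PowerSeries.subst_comp_subst_apply (PowerSeries.HasSubst.of_constantCoeff_zero' hg) h, hfg,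
    PowerSeries.subst_X h]

section Transport

variable {f g : PowerSeries K} (hf : PowerSeries.constantCoeff f = 0)
include hf

theorem constantCoeff_subst_add {τ : Type*} {a b : MvPowerSeries τ K}
    (ha : MvPowerSeries.constantCoeff a = 0) (hb : MvPowerSeries.constantCoeff b = 0) :
    MvPowerSeries.constantCoeff (f.subst a + f.subst b) = 0 := by
  rw [map_add, PowerSeries.constantCoeff_subst_eq_zero ha _ hf,
    PowerSeries.constantCoeff_subst_eq_zero hb _ hf, add_zero]

/-- The value of `g(f(X) + f(Y))` at two power series `a` and `b`. -/
theorem transportAdd_subst {τ : Type*} {a b : MvPowerSeries τ K}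
    (ha : MvPowerSeries.constantCoeff a = 0) (hb : MvPowerSeries.constantCoeff b = 0) :
    (transportAdd f g).subst ![a, b] = g.subst (f.subst a + f.subst b) := by
  have h := hasSubst_pair ha hb
  rw [transportAdd, subst_mvSubst _ (constantCoeff_subst_add hf (by simp) (by simp)) h,
    MvPowerSeries.subst_add h, subst_mvSubst _ (by simp) h, subst_mvSubst _ (by simp) h,
    MvPowerSeries.subst_X h, MvPowerSeries.subst_X h]
  rfl

variable (hg : PowerSeries.constantCoeff g = 0)
include hg

theorem constantCoeff_transportAdd : MvPowerSeries.constantCoeff (transportAdd f g) = 0 :=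
  PowerSeries.constantCoeff_subst_eq_zero (constantCoeff_subst_add hf (by simp) (by simp)) _ hg

theorem coeff_single_transportAdd (hf1 : PowerSeries.coeff 1 f = 1)
    (hg1 : PowerSeries.coeff 1 g = 1) (i : Fin 2) :
    MvPowerSeries.coeff (Finsupp.single i 1) (transportAdd f g) = 1 := by
  rw [transportAdd, coeff_subst_eq_sum (N := 1) _ (constantCoeff_subst_add hf (by simp) (by simp)) _
    (by simp)]
  fin_cases i <;>
    simp [Finset.sum_range_succ, hg, hg1, PowerSeries.coeff_subst_single, hf1]

variable (hfg : f.subst g = (PowerSeries.X : PowerSeries K))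
include hfg

theorem subst_transportAdd :
    f.subst (transportAdd f g) = f.subst (MvPowerSeries.X 0 : MvPowerSeries (Fin 2) K) +
      f.subst (MvPowerSeries.X 1 : MvPowerSeries (Fin 2) K) :=
  subst_subst_of_inverse hg hfg (constantCoeff_subst_add hf (by simp) (by simp))

theorem transportAdd_assoc :
    (transportAdd f g).subst
      ![(transportAdd f g).subst ![(MvPowerSeries.X 0 : MvPowerSeries (Fin 3) K),
        MvPowerSeries.X 1], MvPowerSeries.X 2] =
    (transportAdd f g).subst ![(MvPowerSeries.X 0 : MvPowerSeries (Fin 3) K),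
      (transportAdd f g).subst ![MvPowerSeries.X 1, MvPowerSeries.X 2]] := by
  have hX (i : Fin 3) : MvPowerSeries.constantCoeff (MvPowerSeries.X i : MvPowerSeries (Fin 3) K) =
      0 := by simp
  have hc (i j : Fin 3) := constantCoeff_subst_add hf (hX i) (hX j)
  have hd (i j : Fin 3) := PowerSeries.constantCoeff_subst_eq_zero (hc i j) g hg
  rw [transportAdd_subst hf (hX 0) (hX 1), transportAdd_subst hf (hX 1) (hX 2),
    transportAdd_subst hf (hd 0 1) (hX 2), transportAdd_subst hf (hX 0) (hd 1 2),
    subst_subst_of_inverse hg hfg (hc 0 1), subst_subst_of_inverse hg hfg (hc 1 2), add_assoc]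

/-- The formal group law with logarithm `f`, given the compositional inverse `g` of `f`. -/
def formalGroupOfLog (hf1 : PowerSeries.coeff 1 f = 1) (hg1 : PowerSeries.coeff 1 g = 1) :
    FormalGroup K where
  toPowerSeries := transportAdd f g
  zero_constantCoeff := constantCoeff_transportAdd hf hg
  lin_coeff_X := coeff_single_transportAdd hf hg hf1 hg1 0
  lin_coeff_Y := coeff_single_transportAdd hf hg hf1 hg1 1
  assoc := transportAdd_assoc hf hg hfg

theorem formalGroupOfLog_isComm (hf1 : PowerSeries.coeff 1 f = 1)
    (hg1 : PowerSeries.coeff 1 g = 1) : (formalGroupOfLog hf hg hfg hf1 hg1).IsComm where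
  comm := (((transportAdd_subst hf (by simp) (by simp)).trans (by rw [add_comm]; rfl)).symm :
    transportAdd f g = (transportAdd f g).subst ![MvPowerSeries.X 1, MvPowerSeries.X 0])

end Transport

/-- The functional equation of the exponential, for power series in any set of variables. It follows
from the universal case `a = X`, `b = Y`. -/
theorem exp_subst_add [Algebra ℚ K] {τ : Type*} {a b : MvPowerSeries τ K}
    (ha : MvPowerSeries.constantCoeff a = 0) (hb : MvPowerSeries.constantCoeff b = 0) :
    (PowerSeries.exp K).subst (a + b) =
      (PowerSeries.exp K).subst a * (PowerSeries.exp K).subst b := by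
  have key : (PowerSeries.exp K).subst
      (MvPowerSeries.X 0 + MvPowerSeries.X 1 : MvPowerSeries (Fin 2) K) =
      (PowerSeries.exp K).subst (MvPowerSeries.X 0 : MvPowerSeries (Fin 2) K) *
        (PowerSeries.exp K).subst (MvPowerSeries.X 1 : MvPowerSeries (Fin 2) K) := by
    ext e
    rw [PowerSeries.coeff_subst_X_zero_add_X_one, PowerSeries.coeff_subst_X_zero_subst_mul_X_one]
    simp only [PowerSeries.coeff_exp]
    rw [← map_natCast (algebraMap ℚ K), ← map_mul, ← map_mul]
    congr 1
    -- `(i + j).choose i / (i + j)! = 1 / i! · 1 / j!`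
    rw [Nat.cast_add_choose]
    field_simp
  have h := hasSubst_pair ha hb
  have := congrArg (MvPowerSeries.subst ![a, b]) key
  rwa [MvPowerSeries.subst_mul h, subst_mvSubst _ (by simp) h, subst_mvSubst _ (by simp) h,
    subst_mvSubst _ (by simp) h, MvPowerSeries.subst_add h, MvPowerSeries.subst_X h,
    MvPowerSeries.subst_X h] at this

end FormalGroupLaws

/-! ### The formal group law and the modulus of complex cobordism -/

theorem constantCoeff_logMU : PowerSeries.constantCoeff logMU = 0 := by
  rw [← PowerSeries.coeff_zero_eq_constantCoeff_apply, logMU, PowerSeries.coeff_mk, if_pos rfl]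

theorem coeff_one_logMU : PowerSeries.coeff 1 logMU = 1 := by
  simp [logMU, PowerSeries.coeff_mk, cp]

theorem logMU_subst_fglMU :
    logMU.subst fglMU = logMU.subst (MvPowerSeries.X 0 : MvPowerSeries (Fin 2) Symm) +
      logMU.subst (MvPowerSeries.X 1 : MvPowerSeries (Fin 2) Symm) :=
  subst_transportAdd constantCoeff_logMU constantCoeff_compInv
    (subst_compInv constantCoeff_logMU coeff_one_logMU)

/-- The modulus of `a` is `exp(-log_MU(a))`. -/
theorem stSeries_subst {τ : Type*} {a : MvPowerSeries τ Symm}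
    (ha : MvPowerSeries.constantCoeff a = 0) :
    stSeries.subst a = (PowerSeries.exp Symm).subst (-(logMU.subst a)) := by
  have h := PowerSeries.HasSubst.of_constantCoeff_zero ha
  have hl : PowerSeries.constantCoeff (-logMU) = 0 := by rw [map_neg, constantCoeff_logMU, neg_zero]
  rw [stSeries, PowerSeries.subst_comp_subst_apply (PowerSeries.HasSubst.of_constantCoeff_zero' hl)
      h, ← PowerSeries.coe_substAlgHom h, map_neg]

theorem stSeries_subst_fglMU :
    stSeries.subst fglMU = stSeries.subst (MvPowerSeries.X 0 : MvPowerSeries (Fin 2) Symm) *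
      stSeries.subst (MvPowerSeries.X 1 : MvPowerSeries (Fin 2) Symm) := by
  have hc (i : Fin 2) : MvPowerSeries.constantCoeff
      (-(logMU.subst (MvPowerSeries.X i : MvPowerSeries (Fin 2) Symm)) :
        MvPowerSeries (Fin 2) Symm) = 0 := by
    rw [map_neg, PowerSeries.constantCoeff_subst_eq_zero (by simp) _ constantCoeff_logMU, neg_zero]
  have hF : MvPowerSeries.constantCoeff fglMU = 0 :=
    constantCoeff_transportAdd constantCoeff_logMU constantCoeff_compInv
  rw [stSeries_subst hF, stSeries_subst (by simp), stSeries_subst (by simp), logMU_subst_fglMU,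
    neg_add, exp_subst_add (hc 0) (hc 1)]

/-! ### Power series in a cocycle -/

section Series

variable {X : Type*} [TopologicalSpace X] {K : Type*} [CommRing K]

theorem Cochain.sum_app {ι : Type*} (s : Finset ι) (f : ι → Cochain X K) {n : ℕ} (σ : Sing n X) :
    (∑ i ∈ s, f i) n σ = ∑ i ∈ s, f i n σ := by
  induction s using Finset.cons_induction with
  | empty => rfl
  | cons a s ha ih => rw [sum_cons, sum_cons, Cochain.add_app, ih]

theorem Cochain.pow_app_eq_zero {w : Cochain X K} (hw : w 0 = 0) {n k : ℕ} (h : n < k)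
    (σ : Sing n X) : (w ^ k) n σ = 0 := by
  induction k generalizing n with
  | zero => omega
  | succ k ih =>
    rw [pow_succ, Cochain.mul_app]
    refine sum_eq_zero ?_
    rintro ⟨p, q⟩ hpq
    rw [HasAntidiagonal.mem_antidiagonal] at hpq
    simp only at hpq ⊢
    rcases Nat.eq_zero_or_pos q with rfl | hq
    · rw [hw, Pi.zero_apply, mul_zero]
    · rw [ih (by omega), zero_mul]

/-- The cochain `∑ₖ fₖ wᵏ`, truncated at `k ≤ n` in degree `n`. -/
def Cochain.series (f : PowerSeries K) (w : Cochain X K) : Cochain X K :=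
  fun n σ => ∑ k ∈ range (n + 1), PowerSeries.coeff k f * (w ^ k) n σ

theorem Cochain.series_app (f : PowerSeries K) (w : Cochain X K) {n : ℕ} (σ : Sing n X) :
    Cochain.series f w n σ = ∑ k ∈ range (n + 1), PowerSeries.coeff k f * (w ^ k) n σ := rfl

theorem Cochain.series_neg (f : PowerSeries K) (w : Cochain X K) :
    Cochain.series (-f) w = -Cochain.series f w := by
  ext n σ
  simp [Cochain.series_app]

/-- In degree `n` a power series in `w` is the value of any polynomial that agrees with it up to
order `n`. -/
theorem Cochain.series_app_eq_aeval {w : Cochain X K} (hw : w 0 = 0) {f : PowerSeries K}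
    {p : Polynomial K} {n : ℕ} (hp : ∀ k ≤ n, p.coeff k = PowerSeries.coeff k f) (σ : Sing n X) :
    Cochain.series f w n σ = Polynomial.aeval w p n σ := by
  rw [Polynomial.aeval_eq_sum_range' (n := n + 1 + p.natDegree + 1) (by omega), Cochain.sum_app,
    Cochain.series_app, add_assoc (n + 1), sum_range_add _ (n + 1),
    sum_eq_zero (s := range (p.natDegree + 1)), add_zero]
  · refine sum_congr rfl fun k hk => ?_
    rw [Cochain.smul_app, hp k (by simpa [Nat.lt_succ_iff] using hk)]
  · intro k _
    rw [Cochain.smul_app, Cochain.pow_app_eq_zero hw (by omega), mul_zero]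

/-- In degree `n` both factors may be replaced by polynomials, for which `aeval` is
multiplicative. -/
theorem Cochain.series_mul {w : Cochain X K} (hw : w 0 = 0) (f g : PowerSeries K) :
    Cochain.series (f * g) w = Cochain.series f w * Cochain.series g w := by
  ext n σ
  have ht (h : PowerSeries K) (k : ℕ) (hk : k ≤ n) :
      (h.trunc (n + 1)).coeff k = PowerSeries.coeff k h := by
    rw [PowerSeries.coeff_trunc, if_pos (by omega)]
  rw [Cochain.series_app_eq_aeval hw (p := f.trunc (n + 1) * g.trunc (n + 1)), map_mul,
    Cochain.mul_app, Cochain.mul_app]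
  · refine sum_congr rfl ?_
    rintro ⟨p, q⟩ hpq
    rw [HasAntidiagonal.mem_antidiagonal] at hpq
    simp only at hpq ⊢
    rw [Cochain.series_app_eq_aeval hw fun k hk => ht f k (by omega),
      Cochain.series_app_eq_aeval hw fun k hk => ht g k (by omega)]
  · intro k hk
    rw [Polynomial.coeff_mul, PowerSeries.coeff_mul]
    refine sum_congr rfl ?_
    rintro ⟨p, q⟩ hpq
    rw [HasAntidiagonal.mem_antidiagonal] at hpq
    simp only at hpq ⊢
    rw [ht f p (by omega), ht g q (by omega)]

theorem Cochain.series_one (w : Cochain X K) : Cochain.series 1 w = 1 := by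
  ext n σ
  rw [Cochain.series_app, sum_range_succ', sum_eq_zero]
  · simp
  · intro k _
    simp [PowerSeries.coeff_one]

theorem Cochain.series_pow {w : Cochain X K} (hw : w 0 = 0) (f : PowerSeries K) (k : ℕ) :
    Cochain.series (f ^ k) w = Cochain.series f w ^ k := by
  induction k with
  | zero => rw [pow_zero, pow_zero, Cochain.series_one]
  | succ k ih => rw [pow_succ, pow_succ, Cochain.series_mul hw, ih]

theorem Cochain.series_subst {w : Cochain X K} (hw : w 0 = 0) (f : PowerSeries K)
    {g : PowerSeries K} (hg : PowerSeries.constantCoeff g = 0) :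
    Cochain.series (f.subst g) w = Cochain.series f (Cochain.series g w) := by
  ext n σ
  simp only [Cochain.series_app f, ← Cochain.series_pow hw]
  simp only [Cochain.series_app, mul_sum]
  rw [sum_comm]
  refine sum_congr rfl fun j hj => ?_
  rw [coeff_subst_eq_sum' f hg (by simpa [Nat.lt_succ_iff] using hj : j ≤ n), sum_mul]
  exact sum_congr rfl fun k _ => mul_assoc _ _ _

theorem Cochain.map_pow {L : Type*} [CommRing L] (φ : K →+* L) (w : Cochain X K) (k : ℕ) :
    Cochain.map φ.toAddMonoidHom (w ^ k) = Cochain.map φ.toAddMonoidHom w ^ k := by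
  induction k with
  | zero =>
    ext n σ
    simp [Cochain.map_app, Cochain.one_app, apply_ite φ]
  | succ k ih =>
    rw [pow_succ, pow_succ, ← ih]
    ext n σ
    simp [Cochain.map_app, Cochain.mul_app]

theorem Cochain.map_series {L : Type*} [CommRing L] (φ : K →+* L) (f : PowerSeries K)
    (w : Cochain X K) :
    Cochain.map φ.toAddMonoidHom (Cochain.series f w) =
      Cochain.series (f.map φ) (Cochain.map φ.toAddMonoidHom w) := by
  ext n σ
  simp only [Cochain.series_app, ← Cochain.map_pow]
  simp [Cochain.series_app, Cochain.map_app]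

theorem Cochain.series_smul (c : K) (f : PowerSeries K) (w : Cochain X K) :
    Cochain.series f (c • w) = Cochain.series (f.rescale c) w := by
  ext n σ
  simp only [Cochain.series_app, PowerSeries.coeff_rescale]
  refine sum_congr rfl fun k _ => ?_
  rw [smul_pow, Cochain.smul_app]
  ring

theorem cocycles.d_eq_zero (w : cocycles X K) : Cochain.d (w : Cochain X K) = 0 := w.2

/-- The cocycle `∑ₖ fₖ wᵏ` for a cocycle `w`, truncated at `k ≤ n` in degree `n`. -/
def cocycles.series (f : PowerSeries K) (w : cocycles X K) : cocycles X K :=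
  ⟨Cochain.series f w.1, by
    change Cochain.d _ = 0
    ext n σ
    cases n with
    | zero => rfl
    | succ n =>
      -- in degree `n` the series is a polynomial in `w`, and the coboundary in degree `n + 1` only
      -- depends on this component
      have h := cocycles.d_eq_zero (∑ k ∈ range (n + 1), PowerSeries.coeff k f • w ^ k)
      have h' := congrFun (congrFun h (n + 1)) σ
      rw [Cochain.d_succ_app] at h'
      rw [Cochain.d_succ_app]
      convert h' using 3
      rw [Cochain.series_app]
      push_cast
      rw [Cochain.sum_app]
      rfl⟩

theorem Coh.eval_mk (f : PowerSeries K) (w : cocycles X K) :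
    Coh.eval f (Coh.mk w) = Coh.mk (cocycles.series f w) := by
  have h (n : ℕ) : ∑ k ∈ range (n + 1), PowerSeries.coeff k f • Coh.mk w ^ k =
      Coh.mk (∑ k ∈ range (n + 1), PowerSeries.coeff k f • w ^ k) :=
    (map_sum (cohomologous X K).mk' _ _).symm
  simp only [Coh.eval, h]
  refine Coh.assemble_mk _ _ fun n => ?_
  funext σ
  change Cochain.series f w.1 n σ = _
  push_cast
  rw [Cochain.sum_app]
  rfl

/-- Evaluation is compatible with composition of series; here the argument `-f(x)` of the
exponential need not be homogeneous. -/
theorem Coh.exp_neg_eval [Algebra ℚ K] {f : PowerSeries K} (hf : PowerSeries.constantCoeff f = 0)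
    {w : cocycles X K} (hw : w.1 0 = 0) :
    Coh.exp (-(Coh.eval f (Coh.mk w))) = Coh.eval ((PowerSeries.exp K).subst (-f)) (Coh.mk w) := by
  have h : -(Coh.eval f (Coh.mk w)) = Coh.mk (cocycles.series (-f) w) := by
    rw [Coh.eval_mk]
    exact congrArg Coh.mk (Subtype.ext (Cochain.series_neg f w.1).symm)
  rw [Coh.exp, h, Coh.eval_mk, Coh.eval_mk]
  exact congrArg Coh.mk (Subtype.ext (Cochain.series_subst hw _ (by simp [hf])).symm)

/-! ### Operators on the generating series of the divided powers -/

section ChernCharacter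

open Polynomial

/-- The power series obtained by applying an additive map, not assumed multiplicative, to all
coefficients. -/
def coeffMap {A B : Type*} [CommRing A] [CommRing B] (φ : A →+ B) (F : PowerSeries A) :
    PowerSeries B :=
  PowerSeries.mk fun n => φ (PowerSeries.coeff n F)

@[simp]
theorem coeff_coeffMap {A B : Type*} [CommRing A] [CommRing B] (φ : A →+ B) (F : PowerSeries A)
    (n : ℕ) : PowerSeries.coeff n (coeffMap φ F) = φ (PowerSeries.coeff n F) :=
  PowerSeries.coeff_mk _ _

/-- A coefficient map linear over `K` acts on `∑ₖ Fₖ wᵏ`, where `w` has coefficients in `K`, through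
the coefficients `Fₖ`. -/
theorem Cochain.map_series_of_linear (φ : K[X] →ₗ[K] K[X]) (F : PowerSeries K[X])
    (w : Cochain X K) :
    Cochain.map φ.toAddMonoidHom
        (Cochain.series F (Cochain.map (C : K →+* K[X]).toAddMonoidHom w)) =
      Cochain.series (coeffMap φ.toAddMonoidHom F)
        (Cochain.map (C : K →+* K[X]).toAddMonoidHom w) := by
  ext1 n σ
  simp only [Cochain.map_app, Cochain.series_app, ← Cochain.map_pow, map_sum, coeff_coeffMap]
  refine sum_congr rfl fun k _ => ?_
  change φ (_ * C _) = φ _ * C _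
  rw [mul_comm, ← smul_eq_C_mul, map_smul, smul_eq_C_mul, mul_comm]

/-- The analogue of `Cochain.map_series_of_linear` for a linear functional on `K[T]`, whose values
no longer involve `T`. -/
theorem Cochain.map_series_of_functional (φ : K[X] →ₗ[K] K) (F : PowerSeries K[X])
    (w : Cochain X K) :
    Cochain.map φ.toAddMonoidHom
        (Cochain.series F (Cochain.map (C : K →+* K[X]).toAddMonoidHom w)) =
      Cochain.series (coeffMap φ.toAddMonoidHom F) w := by
  ext1 n σ
  simp only [Cochain.map_app, Cochain.series_app, ← Cochain.map_pow, map_sum, coeff_coeffMap]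
  refine sum_congr rfl fun k _ => ?_
  change φ (_ * C _) = φ _ * _
  rw [mul_comm, ← smul_eq_C_mul, map_smul, smul_eq_mul, mul_comm]

/-- The coefficientwise action of a `K`-linear operator on `K[T]⟦t⟧` is `K⟦t⟧`-linear. -/
theorem coeffMap_map_C_mul (φ : K[X] →ₗ[K] K[X]) (f : PowerSeries K) (F : PowerSeries K[X]) :
    coeffMap φ.toAddMonoidHom (f.map C * F) = f.map C * coeffMap φ.toAddMonoidHom F := by
  ext1 n
  simp only [coeff_coeffMap, PowerSeries.coeff_mul, map_sum, PowerSeries.coeff_map]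
  refine sum_congr rfl fun k _ => ?_
  change φ (C _ * _) = C _ * φ _
  rw [← smul_eq_C_mul, map_smul, smul_eq_C_mul]

theorem basisMonomials_constr_X_pow (g : ℕ → K[X]) (n : ℕ) :
    (basisMonomials K).constr K g (Polynomial.X ^ n) = g n := by
  rw [← (basisMonomials K).constr_basis K g n, X_pow_eq_monomial, coe_basisMonomials]

variable [Algebra ℚ K]

variable (K) in
/-- The generating series `exp(T t) = ∑ₙ Tⁿ / n! · tⁿ` of the divided powers of `T`. -/
def expSeries : PowerSeries K[X] := (PowerSeries.exp K[X]).rescale Polynomial.X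

theorem coeff_expSeries (n : ℕ) :
    PowerSeries.coeff n (expSeries K) = (1 / (n.factorial : ℚ)) • (Polynomial.X ^ n : K[X]) := by
  rw [expSeries, PowerSeries.coeff_rescale, PowerSeries.coeff_exp, mul_comm, ← Algebra.smul_def]

/-- The cocycle of coefficients in `K[T]` underlying a cocycle with coefficients in `K`. -/
def cocycles.toPoly (w : cocycles X K) : cocycles X K[X] :=
  ⟨Cochain.map (C : K →+* K[X]).toAddMonoidHom w.1, by
    change Cochain.d _ = 0
    rw [Cochain.d_map, cocycles.d_eq_zero, map_zero]⟩

theorem coeffMap_neg_expSeries {N : K[X] →ₗ[K] K[X]} {f : PowerSeries K}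
    (h : coeffMap N.toAddMonoidHom (expSeries K) = f.map C * expSeries K) :
    coeffMap ((-1 : ℚ) • N).toAddMonoidHom (expSeries K) =
      PowerSeries.map C (-f) * expSeries K := by
  rw [map_neg, neg_mul, ← h]
  ext1 n
  rw [map_neg, coeff_coeffMap, coeff_coeffMap]
  exact neg_one_smul ℚ (N _)

/-- If `N` multiplies `exp(T t)` by `f(t)`, then `Nᵏ` multiplies it by `f(t)ᵏ`. -/
theorem coeffMap_pow_expSeries {N : K[X] →ₗ[K] K[X]} {f : PowerSeries K}
    (h : coeffMap N.toAddMonoidHom (expSeries K) = f.map C * expSeries K) (k : ℕ) :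
    coeffMap (N ^ k).toAddMonoidHom (expSeries K) = (f ^ k).map C * expSeries K := by
  induction k with
  | zero =>
    ext1 n
    simp
  | succ k ih =>
    have e : coeffMap (N ^ (k + 1)).toAddMonoidHom (expSeries K) =
        coeffMap N.toAddMonoidHom (coeffMap (N ^ k).toAddMonoidHom (expSeries K)) := by
      ext1 n
      simp [pow_succ']
    rw [e, ih, coeffMap_map_C_mul, h, ← mul_assoc, ← map_mul, pow_succ]

/-- An operator with symbol `f(∂_T)` multiplies `exp(T t)` by `f(t)`. -/
theorem coeffMap_expSeries_of_symbol {N : K[X] →ₗ[K] K[X]} {f : PowerSeries K}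
    (h : ∀ n : ℕ, N (Polynomial.X ^ n) = ∑ j ∈ range (n + 1),
      PowerSeries.coeff j f • (derivative^[j]) (Polynomial.X ^ n : K[X])) :
    coeffMap N.toAddMonoidHom (expSeries K) = f.map C * expSeries K := by
  ext1 n
  rw [coeff_coeffMap, coeff_expSeries, PowerSeries.coeff_mul,
    Finset.Nat.sum_antidiagonal_eq_sum_range_succ_mk]
  change N _ = _
  rw [map_rat_smul, h, smul_sum]
  refine sum_congr rfl fun j hj => ?_
  have hj : j ≤ n := by simpa [Nat.lt_succ_iff] using hj
  rw [PowerSeries.coeff_map, coeff_expSeries, iterate_derivative_X_pow_eq_natCast_mul,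
    ← smul_eq_C_mul, smul_comm, ← nsmul_eq_mul, ← Nat.cast_smul_eq_nsmul ℚ, smul_smul,
    ← Nat.factorial_mul_descFactorial hj]
  congr 2
  have h1 : ((n - j).factorial : ℚ) ≠ 0 := by positivity
  have h2 : (n.descFactorial j : ℚ) ≠ 0 := by
    rw [Nat.cast_ne_zero, Ne, Nat.descFactorial_eq_zero_iff_lt]
    omega
  push_cast
  field_simp

/-- If `N` multiplies `exp(T t)` by `f(t)`, then the exponential of `N` multiplies it by
`exp(f(t))`. -/
theorem coeffMap_expSeries_of_exp {N M : K[X] →ₗ[K] K[X]} {f : PowerSeries K}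
    (hf : PowerSeries.constantCoeff f = 0)
    (hN : coeffMap N.toAddMonoidHom (expSeries K) = f.map C * expSeries K)
    (hM : ∀ n : ℕ, M (Polynomial.X ^ n) =
      ∑ k ∈ range (n + 1), (1 / (k.factorial : ℚ)) • (N ^ k) (Polynomial.X ^ n : K[X])) :
    coeffMap M.toAddMonoidHom (expSeries K) =
      PowerSeries.map C ((PowerSeries.exp K).subst f) * expSeries K := by
  ext1 n
  have h1 : PowerSeries.coeff n (coeffMap M.toAddMonoidHom (expSeries K)) =
      ∑ k ∈ range (n + 1), (1 / (k.factorial : ℚ)) •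
        PowerSeries.coeff n ((f ^ k).map C * expSeries K) := by
    rw [coeff_coeffMap, coeff_expSeries]
    change M _ = _
    rw [map_rat_smul, hM, smul_sum]
    refine sum_congr rfl fun k _ => ?_
    rw [← coeffMap_pow_expSeries hN, coeff_coeffMap, coeff_expSeries, smul_comm]
    congr 1
    exact (map_rat_smul (N ^ k) _ _).symm
  rw [h1]
  simp only [PowerSeries.coeff_mul, PowerSeries.coeff_map, smul_sum]
  rw [sum_comm]
  refine sum_congr rfl ?_
  rintro ⟨i, j⟩ hij
  rw [HasAntidiagonal.mem_antidiagonal] at hij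
  simp only at hij ⊢
  rw [coeff_subst_eq_sum' _ hf (by omega : i ≤ n), map_sum, sum_mul]
  refine sum_congr rfl fun k _ => ?_
  rw [PowerSeries.coeff_exp, ← Algebra.smul_def, ← smul_mul_assoc]
  congr 1
  exact smul_C _ _

/-- The class `exp(x T)` is represented by the series `exp(T t)` at `t = w`. -/
theorem Coh.exp_X_smul_mk (w : cocycles X K) :
    Coh.exp ((Polynomial.X : K[X]) • Coh.map (C : K →+* K[X]).toAddMonoidHom (Coh.mk w)) =
      Coh.mk (cocycles.series (expSeries K) (cocycles.toPoly w)) := by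
  refine (Coh.eval_mk _ ((Polynomial.X : K[X]) • cocycles.toPoly w)).trans ?_
  exact congrArg Coh.mk (Subtype.ext (Cochain.series_smul _ _ _))

/-- If `φ` multiplies `exp(T t)` by `f(t)`, then it multiplies `exp(x T)` by `f(x)`. -/
theorem Coh.map_exp_of_linear {φ : K[X] →ₗ[K] K[X]} {f : PowerSeries K}
    (h : coeffMap φ.toAddMonoidHom (expSeries K) = f.map C * expSeries K)
    {w : cocycles X K} (hw : w.1 0 = 0) :
    Coh.map φ.toAddMonoidHom (Coh.exp ((Polynomial.X : K[X]) •
        Coh.map (C : K →+* K[X]).toAddMonoidHom (Coh.mk w))) =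
      Coh.map (C : K →+* K[X]).toAddMonoidHom (Coh.eval f (Coh.mk w)) *
        Coh.exp ((Polynomial.X : K[X]) •
          Coh.map (C : K →+* K[X]).toAddMonoidHom (Coh.mk w)) := by
  have hw' : Cochain.map (C : K →+* K[X]).toAddMonoidHom w.1 0 = 0 := by
    funext σ
    simp [Cochain.map_app, hw]
  rw [Coh.exp_X_smul_mk, Coh.eval_mk]
  change _ = Coh.mk (cocycles.toPoly (cocycles.series f w) *
    cocycles.series (expSeries K) (cocycles.toPoly w))
  refine congrArg Coh.mk (Subtype.ext ?_)
  change Cochain.map φ.toAddMonoidHom (Cochain.series (expSeries K) (Cochain.map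
    (C : K →+* K[X]).toAddMonoidHom w.1)) = Cochain.map (C : K →+* K[X]).toAddMonoidHom
      (Cochain.series f w.1) * Cochain.series (expSeries K) (Cochain.map
    (C : K →+* K[X]).toAddMonoidHom w.1)
  rw [Cochain.map_series_of_linear, h, Cochain.series_mul hw', Cochain.map_series]

/-- If the functional `φ` sends `exp(T t)` to `f(t)`, then it sends `exp(x T)` to `f(x)`. -/
theorem Coh.map_exp_of_functional {φ : K[X] →ₗ[K] K} {f : PowerSeries K}
    (h : coeffMap φ.toAddMonoidHom (expSeries K) = f) (w : cocycles X K) :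
    Coh.map φ.toAddMonoidHom (Coh.exp ((Polynomial.X : K[X]) •
        Coh.map (C : K →+* K[X]).toAddMonoidHom (Coh.mk w))) = Coh.eval f (Coh.mk w) := by
  rw [Coh.exp_X_smul_mk, Coh.eval_mk]
  refine congrArg Coh.mk (Subtype.ext ?_)
  rw [← h]
  exact Cochain.map_series_of_functional _ _ _

/-- Setting `T = 0` in `f(t) exp(T t)` gives `f(t)`. -/
theorem coeffMap_leval_zero {φ : K[X] →ₗ[K] K[X]} {f : PowerSeries K}
    (h : coeffMap φ.toAddMonoidHom (expSeries K) = f.map C * expSeries K) :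
    coeffMap (leval (0 : K) ∘ₗ φ).toAddMonoidHom (expSeries K) = f := by
  ext1 n
  have h' := congrArg (fun F => (PowerSeries.coeff n F).eval 0) h
  rw [coeff_coeffMap]
  refine Eq.trans ?_ (h'.trans ?_)
  · simp only [coeff_coeffMap]
    rfl
  · simp only [PowerSeries.coeff_mul, PowerSeries.coeff_map, coeff_expSeries, eval_finsetSum]
    rw [sum_eq_single (n, 0)]
    · simp
    · rintro ⟨i, j⟩ hij hne
      rw [HasAntidiagonal.mem_antidiagonal] at hij
      have hj : j ≠ 0 := by
        rintro rfl
        exact hne (by simp_all)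
      rw [eval_mul, ← algebraMap_smul K (1 / (j.factorial : ℚ)), eval_smul, eval_pow, eval_X,
        zero_pow hj, smul_zero, mul_zero]
    · simp

end ChernCharacter

end Series

/-! ### The flow and its action on classes -/

section Flow

open Polynomial

theorem coeffMap_logMUDiff :
    coeffMap logMUDiff.toAddMonoidHom (expSeries Symm) = logMU.map C * expSeries Symm :=
  coeffMap_expSeries_of_symbol fun n => basisMonomials_constr_X_pow _ n

/-- Cartier's flow at time `-1` multiplies `exp(T t)` by the modulus `st_MU(t)`. -/
theorem coeffMap_cartierFlow :
    coeffMap (cartierFlow (-1)).toAddMonoidHom (expSeries Symm) =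
      stSeries.map C * expSeries Symm :=
  coeffMap_expSeries_of_exp (by rw [map_neg, constantCoeff_logMU, neg_zero])
    (coeffMap_neg_expSeries coeffMap_logMUDiff) fun n => basisMonomials_constr_X_pow _ n

theorem coeffMap_renorm : coeffMap renorm.toAddMonoidHom (expSeries Symm) = stSeries :=
  coeffMap_leval_zero coeffMap_cartierFlow

end Flow

section Classes

variable {X : Type*} [TopologicalSpace X]

/-- The only consequence of homogeneity that matters: the class has a representative without
component in degree `0`. -/
theorem exists_classMU_eq_mk (lam : C(X, LoopS2)) {b : Coh LoopS2 ℤ} (hb : b.IsHomogeneous 2) :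
    ∃ w : cocycles X Symm, w.1 0 = 0 ∧ classMU lam b = Coh.mk w := by
  obtain ⟨z, hz, rfl⟩ := hb
  refine ⟨⟨Cochain.map (Int.castRingHom Symm).toAddMonoidHom (Cochain.pullback lam z.1), ?_⟩, ?_,
    rfl⟩
  · change Cochain.d _ = 0
    rw [Cochain.d_map, Cochain.d_pullback, cocycles.d_eq_zero, map_zero, map_zero]
  · funext σ
    change Int.castRingHom Symm (z.1 0 _) = 0
    rw [hz 0 (by norm_num), Pi.zero_apply, map_zero]

end Classes

/-! ### Powers of the first letter in quasi-shuffle algebras -/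

section QuasiShuffle

/-- The sum of the words of length `n` with one letter `y_r` and all other letters `y₁`, over the
`n` positions of `y_r`. -/
def markedPowers (r : ℕ+) : ℕ → Words
  | 0 => 0
  | n + 1 => Finsupp.single (r :: List.replicate n 1) 1 + Words.cons 1 (markedPowers r n)

theorem Words.cons_single (a : ℕ+) (u : List ℕ+) (c : ℚ) :
    Words.cons a (Finsupp.single u c) = Finsupp.single (a :: u) c :=
  Finsupp.mapDomain_single

theorem quasiShuffle_nil_left (q : ℚ) (v : List ℕ+) : quasiShuffle q [] v = Finsupp.single v 1 := by
  rw [quasiShuffle]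

theorem quasiShuffle_nil_right (q : ℚ) (u : List ℕ+) :
    quasiShuffle q u [] = Finsupp.single u 1 := by
  cases u <;> rw [quasiShuffle]

theorem markedPowers_one (n : ℕ) :
    markedPowers 1 n = (n : ℚ) • Finsupp.single (List.replicate n 1) 1 := by
  induction n with
  | zero => simp [markedPowers]
  | succ n ih =>
    rw [markedPowers, ih, map_smul, Words.cons_single, ← List.replicate_succ, Nat.cast_succ,
      add_smul, one_smul, add_comm]

/-- Multiplying `y₁ⁿ` by a letter `y_r` inserts `y_r` or adds it to one of the letters. -/
theorem quasiShuffle_letter_replicate (q : ℚ) (r : ℕ+) (n : ℕ) :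
    quasiShuffle q [r] (List.replicate n 1) =
      markedPowers r (n + 1) + q • markedPowers (r + 1) n := by
  induction n with
  | zero => simp [quasiShuffle_nil_right, markedPowers]
  | succ n ih =>
    rw [List.replicate_succ, quasiShuffle, quasiShuffle_nil_left, quasiShuffle_nil_left, ih,
      Words.cons_single, Words.cons_single, markedPowers.eq_2 r (n + 1),
      markedPowers.eq_2 (r + 1), map_add, map_smul, smul_add, List.replicate_succ]
    abel

/-- In the shuffle algebra `y₁ · y₁ⁿ = (n + 1) y₁ⁿ⁺¹`, so the word `y₁ⁿ` is the divided power
`y₁^{·n} / n!` of the letter. -/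
theorem IsCharacter.map_replicate_of_shuffle {A : Type*} [Semiring A] [Module ℚ A]
    [SMulCommClass ℚ A A]
    {ψ : Words →ₗ[ℚ] A} (hψ : IsCharacter 0 ψ) (n : ℕ) :
    ψ (Finsupp.single (List.replicate n 1) 1) =
      (1 / (n.factorial : ℚ)) • ψ (Finsupp.single [1] 1) ^ n := by
  induction n with
  | zero => simpa using hψ.1
  | succ n ih =>
    have h := hψ.2 [1] (List.replicate n 1)
    rw [quasiShuffle_letter_replicate, zero_smul, add_zero, markedPowers_one, map_smul, ih] at h
    have hn : ((n + 1 : ℕ) : ℚ) ≠ 0 := by positivity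
    rw [← inv_smul_smul₀ hn (ψ _), h, mul_smul_comm, smul_smul, pow_succ',
      Nat.factorial_succ]
    congr 1
    push_cast
    field_simp

/-- Newton's identity for a character of the quasi-shuffle product. The letter `y_r` is indexed by
`i = r - 1`. -/
theorem IsCharacter.newton {A : Type*} [CommRing A] [Algebra ℚ A]
    {χ : Words →ₗ[ℚ] A} (hχ : IsCharacter 1 χ) (n : ℕ) :
    (n : ℚ) • χ (Finsupp.single (List.replicate n 1) 1) =
      ∑ i ∈ range n, (-1) ^ i * (χ (Finsupp.single [i.succPNat] 1) *
        χ (Finsupp.single (List.replicate (n - 1 - i) 1) 1)) := by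
  -- each product is a sum of two consecutive marked powers, so the alternating sum telescopes
  have h (m : ℕ) (hm : m ≤ n) : ∑ i ∈ range m, (-1) ^ i * (χ (Finsupp.single [i.succPNat] 1) *
        χ (Finsupp.single (List.replicate (n - 1 - i) 1) 1)) =
      χ (markedPowers 1 n) - (-1) ^ m * χ (markedPowers m.succPNat (n - m)) := by
    induction m with
    | zero =>
      have : Nat.succPNat 0 = 1 := rfl
      simp [this]
    | succ m ih =>
      have e : m.succPNat + 1 = (m + 1).succPNat := rfl
      rw [sum_range_succ, ih (by omega), ← hχ.2, quasiShuffle_letter_replicate, one_smul, map_add,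
        e, show n - 1 - m + 1 = n - m by omega, show n - 1 - m = n - (m + 1) by omega]
      ring
  rw [h n le_rfl, markedPowers_one, map_smul]
  simp [markedPowers]

end QuasiShuffle

/-! ### Newton's identity for the modulus -/

section Newton

theorem derivative_logMU :
    PowerSeries.derivative Symm logMU = PowerSeries.mk cp := by
  ext1 n
  rw [PowerSeries.coeff_derivative, PowerSeries.coeff_mk, logMU, PowerSeries.coeff_mk,
    if_neg (Nat.succ_ne_zero n), Nat.add_sub_cancel, ← Nat.cast_succ, mul_comm, ← nsmul_eq_mul,
    ← Nat.cast_smul_eq_nsmul ℚ, smul_smul]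
  have hn : ((n + 1 : ℕ) : ℚ) ≠ 0 := by positivity
  rw [mul_one_div_cancel hn, one_smul]

theorem hasSubst_neg_logMU : PowerSeries.HasSubst (-logMU) :=
  PowerSeries.HasSubst.of_constantCoeff_zero' (by rw [map_neg, constantCoeff_logMU, neg_zero])

theorem derivative_stSeries :
    PowerSeries.derivative Symm stSeries = -(PowerSeries.mk cp * stSeries) := by
  rw [stSeries, PowerSeries.derivative_subst hasSubst_neg_logMU, PowerSeries.derivative_exp,
    Derivation.map_neg, derivative_logMU]
  ring

theorem coeff_zero_stSeries : PowerSeries.coeff 0 stSeries = 1 := by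
  rw [stSeries, coeff_subst_eq_sum' (N := 0) _ (by rw [map_neg, constantCoeff_logMU, neg_zero])
    le_rfl]
  simp

/-- The coefficients of the modulus satisfy Newton's identity up to signs; this compares
coefficients in `st' = -log' · st`. -/
theorem succ_smul_coeff_stSeries (n : ℕ) :
    ((n + 1 : ℕ) : ℚ) • PowerSeries.coeff (n + 1) stSeries =
      -∑ i ∈ range (n + 1), cp i * PowerSeries.coeff (n - i) stSeries := by
  have h := congrArg (PowerSeries.coeff n) derivative_stSeries
  rw [PowerSeries.coeff_derivative, map_neg, PowerSeries.coeff_mul,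
    Finset.Nat.sum_antidiagonal_eq_sum_range_succ_mk] at h
  simp only [PowerSeries.coeff_mk] at h
  rw [← h, Nat.cast_smul_eq_nsmul, nsmul_eq_mul, mul_comm, Nat.cast_succ]

/-- A character with `χ(y_r) = [ℂP^{r-1}]` sends `∑ₙ y₁ⁿ tⁿ` to `st_MU(-t)`, as both sides satisfy
Newton's recursion. -/
theorem IsCharacter.map_replicate_eq_coeff_stSeries {χ : Words →ₗ[ℚ] Symm} (hχ : IsCharacter 1 χ)
    (hcp : ∀ r : ℕ+, χ (Finsupp.single [r] 1) = cp ((r : ℕ) - 1)) (n : ℕ) :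
    χ (Finsupp.single (List.replicate n 1) 1) = (-1) ^ n * PowerSeries.coeff n stSeries := by
  induction n using Nat.strong_induction_on with
  | _ n ih =>
    rcases n with _ | n
    · rw [pow_zero, one_mul, coeff_zero_stSeries]
      exact hχ.1
    · have hn : ((n + 1 : ℕ) : ℚ) ≠ 0 := by positivity
      refine smul_right_injective Symm hn ?_
      simp only
      rw [hχ.newton, ← mul_smul_comm, succ_smul_coeff_stSeries, ← sum_neg_distrib, mul_sum]
      refine sum_congr rfl fun i hi => ?_
      rw [mem_range] at hi
      rw [hcp, Nat.succPNat_coe, Nat.succ_sub_one, ih _ (by omega), Nat.add_sub_cancel]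
      obtain ⟨m, rfl⟩ : ∃ m, n = i + m := ⟨n - i, by omega⟩
      rw [Nat.add_sub_cancel_left, pow_succ, pow_add]
      ring

theorem apply_smul_neg_X_pow {K : Type*} [CommRing K] [Algebra ℚ K]
    (φ : Polynomial K →ₗ[K] K) (n : ℕ) :
    φ ((1 / (n.factorial : ℚ)) • (-Polynomial.X) ^ n) =
      (-1) ^ n * φ (PowerSeries.coeff n (expSeries K)) := by
  rw [coeff_expSeries, neg_pow, ← smul_eq_mul ((-1 : K) ^ n) (φ _), ← map_smul φ,
    smul_comm ((-1 : K) ^ n), Polynomial.smul_eq_C_mul, Polynomial.C_pow, Polynomial.C_neg,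
    Polynomial.C_1]

/-- Since `ψ(y₁ⁿ) = (-T)ⁿ / n!`, renormalization gives the coefficients of `st_MU(-t)`. -/
theorem renorm_map_replicate {ψ : Words →ₗ[ℚ] Polynomial Symm} (hψ : IsCharacter 0 ψ)
    (h1 : ψ (Finsupp.single [1] 1) = -Polynomial.X) (n : ℕ) :
    renorm (ψ (Finsupp.single (List.replicate n 1) 1)) =
      (-1) ^ n * PowerSeries.coeff n stSeries := by
  have h := hψ.map_replicate_of_shuffle n
  rw [h1] at h
  refine (congrArg renorm h).trans ((apply_smul_neg_X_pow renorm n).trans ?_)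
  rw [← coeffMap_renorm, coeff_coeffMap]
  rfl

end Newton

end Morava
end

theorem mainTheorem2 {X : Type*} [TopologicalSpace X] (lam : C(X, LoopS2))
    (b : Coh LoopS2 ℤ) (hb : b.IsHomogeneous 2) :
    -- the flow multiplies the Chern character by the modulus
    Coh.map (cartierFlow (-1)).toAddMonoidHom (chernMU (classMU lam b)) =
        Coh.map (Polynomial.C : Symm →+* Polynomial Symm).toAddMonoidHom
          (stMU (classMU lam b)) * chernMU (classMU lam b) ∧
    -- renormalization of the Chern character
    Zsh (chernMU (classMU lam b)) = Coh.exp (-(Coh.eval logMU (classMU lam b))) ∧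
    Zsh (chernMU (classMU lam b)) = stMU (classMU lam b) ∧
    -- the modulus is a homomorphism from the formal group law to the multiplicative group
    (∃ F : FormalGroup Symm, F.IsComm ∧ F.toPowerSeries = fglMU ∧
      logMU.subst fglMU = logMU.subst (MvPowerSeries.X 0 : MvPowerSeries (Fin 2) Symm) +
        logMU.subst (MvPowerSeries.X 1 : MvPowerSeries (Fin 2) Symm) ∧
      stSeries.subst fglMU = stSeries.subst (MvPowerSeries.X 0 : MvPowerSeries (Fin 2) Symm) *
        stSeries.subst (MvPowerSeries.X 1 : MvPowerSeries (Fin 2) Symm)) ∧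
    -- renormalization is the change from the shuffle to the quasi-shuffle product
    (∀ (ψ : Words →ₗ[ℚ] Polynomial Symm) (χ : Words →ₗ[ℚ] Symm),
      IsCharacter 0 ψ → ψ (Finsupp.single [1] 1) = -Polynomial.X →
      IsCharacter 1 χ → (∀ r : ℕ+, χ (Finsupp.single [r] 1) = cp ((r : ℕ) - 1)) →
      ∀ n : ℕ, renorm (ψ (Finsupp.single (List.replicate n 1) 1)) =
        χ (Finsupp.single (List.replicate n 1) 1)) := by
  obtain ⟨w, hw, hx⟩ := exists_classMU_eq_mk lam hb
  rw [hx]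
  have hZ : Zsh (chernMU (Coh.mk w)) = stMU (Coh.mk w) :=
    Coh.map_exp_of_functional coeffMap_renorm w
  refine ⟨Coh.map_exp_of_linear coeffMap_cartierFlow hw, ?_, hZ,
    ⟨formalGroupOfLog constantCoeff_logMU constantCoeff_compInv
      (subst_compInv constantCoeff_logMU coeff_one_logMU) coeff_one_logMU
      coeff_one_compInv, formalGroupOfLog_isComm _ _ _ _ _, rfl, logMU_subst_fglMU,
      stSeries_subst_fglMU⟩, fun ψ χ hψ h1 hχ hcp n => ?_⟩
  · rw [hZ, Coh.exp_neg_eval constantCoeff_logMU hw]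
    rfl
  · rw [renorm_map_replicate hψ h1, hχ.map_replicate_eq_coeff_stSeries hcp]
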